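/- Consider a single-server queue with $K$ customer classes in a random environment. The environment $Z$ is an irreducible continuous-time Markov chain on $\{1,\dots,D\}$ with generator matrix $Q=(q_{d\ell})$ and invariant distribution $(\pi_1,\dots,\pi_D)$. While the environment is in state $d$, customers arrive according to a Poisson process with rate $\lambda_d\ge 0$, an arriving customer is of class $k$ with probability $\alpha_{k,d}$ ($\sum_k\alpha_{k,d}=1$), and the server has capacity $c_d\ge 0$. Put $\lambda_{k,d}=\alpha_{k,d}\lambda_d$, and assume that for each $k$ there is a $d$ with $\lambda_{k,d}>0$. Class-$k$ customers have exponentially distributed service requirements with mean $1/\mu_k$, $\mu_k>0$, and the server works under discriminatory processor sharing with weights $g_1,\dots,g_K>0$. Thus, with $M_k$ the number of class-$k$ customers and $\mu_{k,d}=\mu_k c_d$, the pair $(\vec M,Z)$ is the continuous-time Markov chain on $\mathbb N^K\times\{1,\dots,D\}$ with the following transition rates out of a state $(\vec m,d)$: $\lambda_{k,d}$ to $(\vec m+\vec e_k,d)$; $\mu_{k,d}\,g_km_k/\sum_j g_jm_j$ to $(\vec m-\vec e_k,d)$ if $m_k>0$; and $q_{d\ell}$ to $(\vec m,\ell)$ for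 $\ell\neq d$. Let $\lambda_{k,\infty}=\sum_d\lambda_{k,d}\pi_d$. Suppose that the queue is stable, that is, that this Markov chain has a stationary distribution, and let $(\vec M,Z)=(M_1,\dots,M_K,Z)$ be in steady state, that is, distributed according to a stationary distribution. Then, for every $k=1,\dots,K$, \[ \lambda_{k,\infty} = \sum_{d=1}^D \mu_{k,d}\, \mathbb E\left[\frac{g_k M_k}{\sum_j g_j M_j}\cdot \mathbf 1_{\{\sum_j M_j>0 \}} \cdot \mathbf 1_{\{Z=d\}} \right]. \] Furthermore, $\mathbb E[M_k]<\infty$ for every $k$, and the state-dependent expectations of the $M_k$ satisfy \[ \sum_{d=1}^D c_d\, \mathbb E[M_k \mathbf 1_{\{Z=d\}} ]= \frac{\lambda_{k,\infty}}{\mu_k} + \sum_{d=1}^D\sum_{j=1}^K g_j\,\frac{\lambda_{k,d}\, \mathbb E[M_j \mathbf 1_{\{Z=d\}} ] + \lambda_{j,d}\, \mathbb E[M_k\mathbf 1_{\{Z=d\}}] } {\mu_kg_k + \mu_jg_j}. \] -/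

import Mathlib

open MeasureTheory
open scoped BoundedContinuousFunction

/-- The uniformly continuous semigroup `exp (t A)` generated by a bounded operator `A`. -/
noncomputable def expSemigroup {E : Type*} [NormedAddCommGroup E] [NormedSpace ℝ E]
    (A : E →L[ℝ] E) (t : ℝ) : E →L[ℝ] E :=
  NormedSpace.exp (t • A)

/-- Parameters of the Markov-modulated multi-class `M/M/1` queue under discriminatory processor
sharing, with customer classes `Fin K` and environment states `Fin D`. -/
structure ModulatedDPS (K D : ℕ) where
  /-- generator matrix of the environment -/
  Q : Matrix (Fin D) (Fin D) ℝ
  /-- total Poisson arrival rate in each environment state -/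
  lam : Fin D → ℝ
  /-- `alpha k d` is the probability that a customer arriving in state `d` is of class `k` -/
  alpha : Fin K → Fin D → ℝ
  /-- a class-`k` service requirement is exponential with mean `1 / mu k` -/
  mu : Fin K → ℝ
  /-- service capacity in each environment state -/
  c : Fin D → ℝ
  /-- weights of the classes -/
  g : Fin K → ℝ
  Q_offDiag_nonneg : ∀ d l, d ≠ l → 0 ≤ Q d l
  Q_row_sum : ∀ d, ∑ l, Q d l = 0
  Q_irreducible : ∀ d l, Relation.ReflTransGen (fun a b => 0 < Q a b) d l
  lam_nonneg : ∀ d, 0 ≤ lam d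
  alpha_nonneg : ∀ k d, 0 ≤ alpha k d
  alpha_sum : ∀ d, ∑ k, alpha k d = 1
  exists_arrival_pos : ∀ k, ∃ d, 0 < alpha k d * lam d
  mu_pos : ∀ k, 0 < mu k
  c_nonneg : ∀ d, 0 ≤ c d
  g_pos : ∀ k, 0 < g k

namespace ModulatedDPS

variable {K D : ℕ} (S : ModulatedDPS K D)

/-- Arrival rate `λ_{k,d}` of class-`k` customers in environment state `d`. -/
def arrivalRate (k : Fin K) (d : Fin D) : ℝ := S.alpha k d * S.lam d

/-- Service rate `μ_{k,d} = μ_k c_d` of class `k` in environment state `d`. -/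
def serviceRate (k : Fin K) (d : Fin D) : ℝ := S.mu k * S.c d

/-- `p` is an invariant distribution of the environment. -/
def IsInvariantEnv (p : Fin D → ℝ) : Prop :=
  (∀ d, 0 ≤ p d) ∧ ∑ d, p d = 1 ∧ Matrix.vecMul p S.Q = 0

/-- Average arrival rate `λ_{k,∞}` of class `k`, with respect to a distribution `p` of the
environment. -/
def avgArrivalRate (p : Fin D → ℝ) (k : Fin K) : ℝ := ∑ d, S.arrivalRate k d * p d

/-- Fraction `g_k m_k / ∑_j g_j m_j` of the capacity that is given to class `k` as a whole when the
queue length vector is `m`; it is `0` if the queue is empty. -/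
noncomputable def share (k : Fin K) (m : Fin K → ℕ) : ℝ :=
  S.g k * m k / ∑ j, S.g j * m j

/-- The action of the infinitesimal generator of the Markov chain `(M, Z)` on functions of the
state `(m, d)`: class-`k` arrivals at rate `λ_{k,d}`, class-`k` departures at rate
`μ_{k,d} g_k m_k / ∑_j g_j m_j`, and changes of the environment from `d` to `l` at rate `Q d l`. -/
noncomputable def generatorFun (f : (Fin K → ℕ) × Fin D → ℝ) (x : (Fin K → ℕ) × Fin D) : ℝ :=
  ∑ k, S.arrivalRate k x.2 * (f (x.1 + Pi.single k 1, x.2) - f x)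
    + ∑ k, S.serviceRate k x.2 * S.share k x.1 * (f (x.1 - Pi.single k 1, x.2) - f x)
    + ∑ l, S.Q x.2 l * (f (x.1, l) - f x)

theorem share_nonneg (k : Fin K) (m : Fin K → ℕ) : 0 ≤ S.share k m :=
  div_nonneg (mul_nonneg (S.g_pos k).le (Nat.cast_nonneg _))
    (Finset.sum_nonneg fun j _ => mul_nonneg (S.g_pos j).le (Nat.cast_nonneg _))

theorem share_le_one (k : Fin K) (m : Fin K → ℕ) : S.share k m ≤ 1 :=
  div_le_one_of_le₀
    (Finset.single_le_sum (f := fun j => S.g j * (m j : ℝ))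
      (fun j _ => mul_nonneg (S.g_pos j).le (Nat.cast_nonneg _)) (Finset.mem_univ k))
    (Finset.sum_nonneg fun j _ => mul_nonneg (S.g_pos j).le (Nat.cast_nonneg _))

/-- A bound on all transition rates out of a state. -/
def rateBound : ℝ :=
  ∑ d, (∑ k, |S.arrivalRate k d| + ∑ k, |S.serviceRate k d| + ∑ l, |S.Q d l|)

theorem generatorFun_bound (f : (Fin K → ℕ) × Fin D →ᵇ ℝ) (x : (Fin K → ℕ) × Fin D) :
    ‖S.generatorFun f x‖ ≤ 2 * S.rateBound * ‖f‖ := by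
  have hf : ∀ y, |f y - f x| ≤ 2 * ‖f‖ := fun y => by
    have h1 := f.norm_coe_le_norm y
    have h2 := f.norm_coe_le_norm x
    rw [Real.norm_eq_abs] at h1 h2
    have h3 := abs_sub (f y) (f x)
    linarith
  have h1 : |∑ k, S.arrivalRate k x.2 * (f (x.1 + Pi.single k 1, x.2) - f x)|
      ≤ (∑ k, |S.arrivalRate k x.2|) * (2 * ‖f‖) := by
    rw [Finset.sum_mul]
    refine (Finset.abs_sum_le_sum_abs _ _).trans (Finset.sum_le_sum fun k _ => ?_)
    rw [abs_mul]
    exact mul_le_mul_of_nonneg_left (hf _) (abs_nonneg _)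
  have h2 : |∑ k, S.serviceRate k x.2 * S.share k x.1 * (f (x.1 - Pi.single k 1, x.2) - f x)|
      ≤ (∑ k, |S.serviceRate k x.2|) * (2 * ‖f‖) := by
    rw [Finset.sum_mul]
    refine (Finset.abs_sum_le_sum_abs _ _).trans (Finset.sum_le_sum fun k _ => ?_)
    rw [abs_mul, abs_mul, abs_of_nonneg (S.share_nonneg k x.1)]
    exact mul_le_mul (mul_le_of_le_one_right (abs_nonneg _) (S.share_le_one k x.1)) (hf _)
      (abs_nonneg _) (abs_nonneg _)
  have h3 : |∑ l, S.Q x.2 l * (f (x.1, l) - f x)| ≤ (∑ l, |S.Q x.2 l|) * (2 * ‖f‖) := by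
    rw [Finset.sum_mul]
    refine (Finset.abs_sum_le_sum_abs _ _).trans (Finset.sum_le_sum fun k _ => ?_)
    rw [abs_mul]
    exact mul_le_mul_of_nonneg_left (hf _) (abs_nonneg _)
  have h4 : (∑ k, |S.arrivalRate k x.2| + ∑ k, |S.serviceRate k x.2| + ∑ l, |S.Q x.2 l|)
      ≤ S.rateBound :=
    Finset.single_le_sum
      (f := fun d => ∑ k, |S.arrivalRate k d| + ∑ k, |S.serviceRate k d| + ∑ l, |S.Q d l|)
      (fun d _ => by positivity) (Finset.mem_univ x.2)
  have h5 := mul_le_mul_of_nonneg_right h4 (by positivity : 0 ≤ 2 * ‖f‖)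
  rw [Real.norm_eq_abs]
  unfold generatorFun
  refine (abs_add_three _ _ _).trans ?_
  nlinarith

/-- The infinitesimal generator of `(M, Z)` as a bounded operator on the bounded functions on the
(discrete) state space. -/
noncomputable def generator :
    ((Fin K → ℕ) × Fin D →ᵇ ℝ) →L[ℝ] ((Fin K → ℕ) × Fin D →ᵇ ℝ) :=
  LinearMap.mkContinuous
    { toFun := fun f => BoundedContinuousFunction.ofNormedAddCommGroupDiscrete
        (S.generatorFun f) _ (S.generatorFun_bound f)
      map_add' := fun f g => by
        ext x
        simp only [BoundedContinuousFunction.coe_ofNormedAddCommGroupDiscrete,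
          BoundedContinuousFunction.coe_add, Pi.add_apply, generatorFun, add_sub_add_comm,
          mul_add, Finset.sum_add_distrib]
        ring
      map_smul' := fun a f => by
        ext x
        simp only [BoundedContinuousFunction.coe_ofNormedAddCommGroupDiscrete,
          BoundedContinuousFunction.coe_smul, smul_eq_mul, generatorFun, RingHom.id_apply,
          ← mul_sub, mul_left_comm _ a, ← Finset.mul_sum]
        ring }
    (2 * S.rateBound) (fun f => BoundedContinuousFunction.norm_ofNormedAddCommGroup_le _
      (mul_nonneg (mul_nonneg zero_le_two
        (Finset.sum_nonneg fun _ _ => by positivity)) (norm_nonneg _)) (S.generatorFun_bound f))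

@[simp] theorem generator_apply (f : (Fin K → ℕ) × Fin D →ᵇ ℝ) (x : (Fin K → ℕ) × Fin D) :
    S.generator f x = S.generatorFun f x := rfl

/-- The transition semigroup of the Markov chain `(M(t), Z(t))`: `S.semigroup t f x` is the
expectation of `f (M(t), Z(t))` for the chain started in `x`. All transition rates are bounded, so
that the semigroup is the exponential of its generator. -/
noncomputable def semigroup (t : ℝ) :
    ((Fin K → ℕ) × Fin D →ᵇ ℝ) →L[ℝ] ((Fin K → ℕ) × Fin D →ᵇ ℝ) :=
  expSemigroup S.generator t

/-- `ν` is a steady-state (stationary) distribution of the Markov chain `(M(t), Z(t))`. -/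
def IsSteadyState (ν : Measure ((Fin K → ℕ) × Fin D)) : Prop :=
  IsProbabilityMeasure ν ∧
    ∀ t : ℝ, 0 ≤ t → ∀ f : (Fin K → ℕ) × Fin D →ᵇ ℝ, ∫ x, S.semigroup t f x ∂ν = ∫ x, f x ∂ν

end ModulatedDPS

/-!
A stationary distribution annihilates the generator on bounded functions and, by truncation, on
functions whose increments are dominated by an integrable function. The functions `M_k`, corrected
by solutions of Poisson equations `Q h = u - π u` for the environment, give the rate balance. The
same correction turns the workload `∑ k, M_k / μ_k` into a Lyapunov function with constant drift
off the empty queue; the drift is negative because its absolute value equals the mean idle capacity,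
and a stationary distribution charges the empty queue in some environment state with positive
capacity. Hence the means are finite, and the products `M_j M_k` have integrable increments.
Their stationarity involves the expectations of `c share_j M_k` and `c share_k M_j`, which are
proportional since `g_k share_j M_k = g_j share_k M_j`; summing over `j` with `∑ j, share_j = 1`
isolates the expectation of `c M_k`.
-/

open scoped Matrix

/-! ### Generator matrices -/

/-- A generator matrix (`Q`-matrix) of an irreducible continuous-time Markov chain on `ι`. -/
structure IsIrreducibleGenerator {ι : Type*} [Fintype ι] (Q : Matrix ι ι ℝ) : Prop where
  offDiag_nonneg : ∀ i j, i ≠ j → 0 ≤ Q i j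
  row_sum : ∀ i, ∑ j, Q i j = 0
  irreducible : ∀ i j, Relation.ReflTransGen (fun a b => 0 < Q a b) i j

namespace IsIrreducibleGenerator

variable {ι : Type*} [Fintype ι] {Q : Matrix ι ι ℝ} (hQ : IsIrreducibleGenerator Q)
include hQ

theorem mulVec_const (a : ℝ) : Q *ᵥ (fun _ => a) = 0 := by
  ext i
  simp only [Matrix.mulVec, dotProduct, ← Finset.sum_mul, hQ.row_sum, zero_mul, Pi.zero_apply]

theorem mulVec_apply_eq_sum_sub (v : ι → ℝ) (i : ι) :
    (Q *ᵥ v) i = ∑ j, Q i j * (v j - v i) := by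
  simp only [Matrix.mulVec, dotProduct, mul_sub, Finset.sum_sub_distrib, ← Finset.sum_mul,
    hQ.row_sum, zero_mul, sub_zero]

/-- Maximum principle: where `v` is maximal, every term of `∑ j, Q i j * (v i - v j)` is
nonnegative, so that the maximum propagates along the transitions. -/
theorem eq_of_mulVec_eq_zero {v : ι → ℝ} (hv : Q *ᵥ v = 0) (i j : ι) : v i = v j := by
  obtain ⟨m, -, hm⟩ := Finset.exists_max_image Finset.univ v ⟨i, Finset.mem_univ i⟩
  suffices h : ∀ j, v j = v m by rw [h i, h j]
  intro j
  induction hQ.irreducible m j with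
  | refl => rfl
  | @tail a b _ hab ha =>
    have hnonneg : ∀ l ∈ Finset.univ, 0 ≤ Q a l * (v a - v l) := fun l hl => by
      rcases eq_or_ne a l with rfl | hal
      · simp
      · exact mul_nonneg (hQ.offDiag_nonneg a l hal) (sub_nonneg.2 (ha ▸ hm l hl))
    have hsum : ∑ l, Q a l * (v a - v l) = 0 := by
      simpa only [hQ.mulVec_apply_eq_sum_sub, ← neg_sub (v a), mul_neg, Finset.sum_neg_distrib,
        neg_eq_zero, Pi.zero_apply] using congrFun hv a
    have hterm := (Finset.sum_eq_zero_iff_of_nonneg hnonneg).1 hsum b (Finset.mem_univ b)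
    rw [← ha, sub_eq_zero.1 ((mul_eq_zero.1 hterm).resolve_left hab.ne')]

theorem pos_of_vecMul_eq_zero {p : ι → ℝ} (hp : p ᵥ* Q = 0) (hp₀ : 0 ≤ p) (hp₁ : p ≠ 0) (j : ι) :
    0 < p j := by
  obtain ⟨i, hi⟩ := Function.ne_iff.1 hp₁
  induction hQ.irreducible i j with
  | refl => exact (hp₀ i).lt_of_ne' hi
  | @tail a b _ hab ha =>
    refine (hp₀ b).lt_of_ne' fun hb => ?_
    have hnonneg : ∀ l ∈ Finset.univ, 0 ≤ p l * Q l b := fun l _ => by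
      rcases eq_or_ne l b with rfl | hl
      · simp [hb]
      · exact mul_nonneg (hp₀ l) (hQ.offDiag_nonneg l b hl)
    have hterm := (Finset.sum_eq_zero_iff_of_nonneg hnonneg).1 (congrFun hp b) a
      (Finset.mem_univ a)
    exact (mul_pos ha hab).ne' hterm

theorem finrank_ker_mulVecLin_le_one : Module.finrank ℝ (LinearMap.ker Q.mulVecLin) ≤ 1 := by
  have hle : LinearMap.ker Q.mulVecLin ≤ Submodule.span ℝ {1} := fun v hv => by
    rcases isEmpty_or_nonempty ι with _ | ⟨⟨i⟩⟩
    · rw [Subsingleton.elim v 0]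
      exact zero_mem _
    · refine Submodule.mem_span_singleton.2 ⟨v i, funext fun j => ?_⟩
      simpa using hQ.eq_of_mulVec_eq_zero hv i j
  exact (Submodule.finrank_mono hle).trans
    (by simpa using finrank_span_le_card (R := ℝ) ({1} : Set (ι → ℝ)))

/-- The Poisson equation `Q h = r` is solvable as soon as `r` is centred: the range of `Q` lies in
the kernel of `p`, and both have codimension one. -/
theorem exists_mulVec_eq {p r : ι → ℝ} (hp : p ᵥ* Q = 0) (hp₁ : p ≠ 0) (hr : p ⬝ᵥ r = 0) :
    ∃ h, Q *ᵥ h = r := by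
  have hφ : dotProductBilin ℝ ℝ p ≠ 0 := fun h =>
    hp₁ (dotProduct_self_eq_zero.1 (LinearMap.congr_fun h p))
  have hle : LinearMap.range Q.mulVecLin ≤ LinearMap.ker (dotProductBilin ℝ ℝ p) := by
    rintro _ ⟨h, rfl⟩
    change p ⬝ᵥ Q *ᵥ h = 0
    rw [Matrix.dotProduct_mulVec, hp, zero_dotProduct]
  have hrange : LinearMap.range Q.mulVecLin = LinearMap.ker (dotProductBilin ℝ ℝ p) := by
    refine Submodule.eq_of_le_of_finrank_le hle ?_
    have hQrank := Q.mulVecLin.finrank_range_add_finrank_ker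
    have hprank := Module.Dual.finrank_ker_add_one_of_ne_zero hφ
    have hker := hQ.finrank_ker_mulVecLin_le_one
    omega
  exact hrange.ge hr

theorem exists_nonneg_mulVec_eq {p r : ι → ℝ} (hp : p ᵥ* Q = 0) (hp₁ : p ≠ 0)
    (hr : p ⬝ᵥ r = 0) : ∃ h, 0 ≤ h ∧ Q *ᵥ h = r := by
  obtain ⟨h, hh⟩ := hQ.exists_mulVec_eq hp hp₁ hr
  refine ⟨h + fun _ => ∑ j, |h j|, fun i => ?_, by rw [Matrix.mulVec_add, hh, hQ.mulVec_const,
    add_zero]⟩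
  have := Finset.single_le_sum (f := fun j => |h j|) (fun _ _ => abs_nonneg _) (Finset.mem_univ i)
  simp only [Pi.zero_apply, Pi.add_apply]
  linarith [neg_abs_le (h i)]

end IsIrreducibleGenerator

/-! ### Integrability -/

theorem integrable_of_abs_le {X : Type*} [MeasurableSpace X] [DiscreteMeasurableSpace X]
    {ν : Measure X} [IsFiniteMeasure ν] {f : X → ℝ} {C : ℝ} (hf : ∀ x, |f x| ≤ C) :
    Integrable f ν :=
  Integrable.of_bound Measurable.of_discrete.aestronglyMeasurable C (ae_of_all _ hf)

theorem integrable_of_integral_min_natCast_le {X : Type*} [MeasurableSpace X] {ν : Measure X}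
    [IsFiniteMeasure ν] {f : X → ℝ} {C : ℝ} (hf : Measurable f) (hf₀ : 0 ≤ f)
    (hC : ∀ N : ℕ, ∫ x, min (f x) N ∂ν ≤ C) : Integrable f ν := by
  have hmeas : ∀ N : ℕ, MeasurableSet {x | f x ≤ N} := fun N => measurableSet_le hf measurable_const
  have hmin₀ : ∀ (N : ℕ) x, 0 ≤ min (f x) N := fun N x => le_min (hf₀ x) N.cast_nonneg
  have hmin : ∀ N : ℕ, Integrable (fun x => min (f x) N) ν := fun N =>
    Integrable.of_bound (hf.min measurable_const).aestronglyMeasurable N (ae_of_all _ fun x => by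
      rw [Real.norm_eq_abs, abs_of_nonneg (hmin₀ N x)]
      exact min_le_right _ _)
  have hcover : AECover ν Filter.atTop fun N : ℕ => {x | f x ≤ N} :=
    ⟨ae_of_all _ fun x => (Filter.eventually_ge_atTop ⌈f x⌉₊).mono fun _ => Nat.ceil_le.1, hmeas⟩
  have heq : ∀ N : ℕ, Set.EqOn f (fun x => min (f x) N) {x | f x ≤ N} := fun _ _ hx =>
    (min_eq_left hx).symm
  refine hcover.integrable_of_integral_bounded_of_nonneg_ae C (fun N => ?_)
    (ae_of_all _ hf₀) (Filter.Eventually.of_forall fun N => ?_)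
  · exact (integrableOn_congr_fun (heq N) (hmeas N)).2 (hmin N).integrableOn
  · rw [setIntegral_congr_fun (hmeas N) (heq N)]
    exact (setIntegral_le_integral (hmin N) (ae_of_all _ (hmin₀ N))).trans (hC N)

theorem integrable_mul_ite_eq {Ω ι : Type*} [MeasurableSpace Ω] {P : Measure Ω}
    [DecidableEq ι] [MeasurableSpace ι] [MeasurableSingletonClass ι] {Z : Ω → ι}
    (hZ : Measurable Z) {Y : Ω → ℝ} (hY : Integrable Y P) (i : ι) :
    Integrable (fun ω => Y ω * if Z ω = i then 1 else 0) P := by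
  refine (hY.indicator (hZ (measurableSet_singleton i))).congr (ae_of_all _ fun ω => ?_)
  by_cases h : Z ω = i <;> simp [Set.indicator, h]

theorem sum_mul_integral_mul_ite_eq {Ω ι : Type*} [MeasurableSpace Ω] {P : Measure Ω} [Fintype ι]
    [DecidableEq ι] [MeasurableSpace ι] [MeasurableSingletonClass ι] {Z : Ω → ι}
    (hZ : Measurable Z) {Y : Ω → ℝ} (hY : Integrable Y P) (u : ι → ℝ) :
    ∑ i, u i * ∫ ω, Y ω * (if Z ω = i then 1 else 0) ∂P = ∫ ω, u (Z ω) * Y ω ∂P := by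
  simp only [← integral_const_mul]
  rw [← integral_finsetSum _ fun i _ => (integrable_mul_ite_eq hZ hY i).const_mul (u i)]
  simp only [mul_ite, mul_one, mul_zero, Finset.sum_ite_eq, Finset.mem_univ, if_true]

theorem integral_pos_of_measure_singleton_ne_zero {X : Type*} [MeasurableSpace X] {ν : Measure X}
    {f : X → ℝ} (hf₀ : 0 ≤ᵐ[ν] f) (hf : Integrable f ν) {x : X} (hx : 0 < f x) (hνx : ν {x} ≠ 0) :
    0 < ∫ y, f y ∂ν :=
  (integral_pos_iff_support_of_nonneg_ae hf₀ hf).2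
    (hνx.bot_lt.trans_le (measure_mono (Set.singleton_subset_iff.2 hx.ne')))

/-! ### The Huber function -/

/-- The Huber function: quadratic up to `N` and linear with slope `N` from there on, that is, the
primitive of `v ↦ min v N`. Its increments are bounded by a multiple of the displacement, which
makes it an admissible substitute for `v ↦ v ^ 2 / 2` when no moments are known to be finite. -/
noncomputable def huber (N v : ℝ) : ℝ := v ^ 2 / 2 - max (v - N) 0 ^ 2 / 2

theorem huber_sub_le (N v w : ℝ) :
    huber N w - huber N v ≤ min v N * (w - v) + (w - v) ^ 2 / 2 := by
  unfold huber
  rcases le_total v N with hv | hv <;> rcases le_total w N with hw | hw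
  · rw [max_eq_right (sub_nonpos.2 hv), max_eq_right (sub_nonpos.2 hw), min_eq_left hv]
    linarith
  · rw [max_eq_right (sub_nonpos.2 hv), max_eq_left (sub_nonneg.2 hw), min_eq_left hv]
    nlinarith [sq_nonneg (w - N)]
  · rw [max_eq_left (sub_nonneg.2 hv), max_eq_right (sub_nonpos.2 hw), min_eq_right hv]
    nlinarith [mul_nonneg (sub_nonneg.2 hv) (sub_nonneg.2 hw), sq_nonneg (v - N)]
  · rw [max_eq_left (sub_nonneg.2 hv), max_eq_left (sub_nonneg.2 hw), min_eq_right hv]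
    nlinarith [sq_nonneg (w - v)]

theorem abs_huber_sub_le {N v w : ℝ} (hN : 0 ≤ N) (hv : 0 ≤ v) (hw : 0 ≤ w) :
    |huber N w - huber N v| ≤ N * |w - v| + (w - v) ^ 2 / 2 := by
  have hmin : ∀ u t : ℝ, 0 ≤ u → min u N * t ≤ N * |t| := fun u t hu =>
    (mul_le_mul_of_nonneg_left (le_abs_self t) (le_min hu hN)).trans
      (mul_le_mul_of_nonneg_right (min_le_right u N) (abs_nonneg t))
  rw [abs_sub_le_iff]
  constructor
  · linarith [huber_sub_le N v w, hmin v (w - v) hv]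
  · have := huber_sub_le N w v
    rw [← neg_sub w v, neg_sq] at this
    have := hmin w (-(w - v)) hw
    rw [abs_neg] at this
    linarith

/-! ### Jump processes with bounded rates -/

/-- The transition rates of a continuous-time Markov chain on `X`: from the state `x` a transition
of type `t : T` leads to `target t x` and occurs at rate `rate t x`. Transitions that do not change
the state are allowed. -/
structure JumpRates (T X : Type*) [Fintype T] where
  rate : T → X → ℝ
  target : T → X → X
  /-- a bound on the total rate out of a state -/
  rateBound : ℝ
  rate_nonneg : ∀ t x, 0 ≤ rate t x
  sum_rate_le : ∀ x, ∑ t, rate t x ≤ rateBound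

namespace JumpRates

variable {T X : Type*} [Fintype T] (J : JumpRates T X)

/-- The infinitesimal generator of the chain, on all (possibly unbounded) functions. -/
def generator : (X → ℝ) →ₗ[ℝ] X → ℝ where
  toFun f x := ∑ t, J.rate t x * (f (J.target t x) - f x)
  map_add' f g := by
    ext x
    simp only [Pi.add_apply, add_sub_add_comm, mul_add, Finset.sum_add_distrib]
  map_smul' a f := by
    ext x
    simp only [Pi.smul_apply, smul_eq_mul, ← mul_sub, mul_left_comm _ a, ← Finset.mul_sum,
      RingHom.id_apply]

theorem generator_apply (f : X → ℝ) (x : X) :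
    J.generator f x = ∑ t, J.rate t x * (f (J.target t x) - f x) := rfl

/-- The carré du champ operator, which measures the failure of the Leibniz rule for `generator`. -/
def carreDuChamp (f g : X → ℝ) (x : X) : ℝ :=
  ∑ t, J.rate t x * ((f (J.target t x) - f x) * (g (J.target t x) - g x))

theorem generator_mul (f g : X → ℝ) :
    J.generator (f * g) = f * J.generator g + g * J.generator f + J.carreDuChamp f g := by
  ext x
  simp only [Pi.add_apply, Pi.mul_apply, generator_apply, carreDuChamp, Finset.mul_sum,
    ← Finset.sum_add_distrib]
  exact Finset.sum_congr rfl fun t _ => by ring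

theorem sum_rate_mul_le {b : ℝ} (hb : 0 ≤ b) {u : T → ℝ} (hu : ∀ t, u t ≤ b) (x : X) :
    ∑ t, J.rate t x * u t ≤ J.rateBound * b :=
  calc ∑ t, J.rate t x * u t ≤ (∑ t, J.rate t x) * b := by
        rw [Finset.sum_mul]
        exact Finset.sum_le_sum fun t _ => mul_le_mul_of_nonneg_left (hu t) (J.rate_nonneg t x)
    _ ≤ J.rateBound * b := mul_le_mul_of_nonneg_right (J.sum_rate_le x) hb

theorem abs_sum_rate_mul_le {b : ℝ} (hb : 0 ≤ b) {u : T → ℝ} {x : X} (hu : ∀ t, |u t| ≤ b) :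
    |∑ t, J.rate t x * u t| ≤ J.rateBound * b := by
  refine (Finset.abs_sum_le_sum_abs _ _).trans ?_
  simp only [abs_mul, abs_of_nonneg (J.rate_nonneg _ x)]
  exact J.sum_rate_mul_le hb hu x

theorem abs_generator_le {f : X → ℝ} {b : ℝ} {x : X} (hb : 0 ≤ b)
    (hf : ∀ t, |f (J.target t x) - f x| ≤ b) : |J.generator f x| ≤ J.rateBound * b :=
  J.abs_sum_rate_mul_le hb hf

theorem generator_huber_le {V : X → ℝ} {δ : ℝ} (hδ : ∀ t x, |V (J.target t x) - V x| ≤ δ)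
    (N : ℝ) (x : X) :
    J.generator (fun y => huber N (V y)) x
      ≤ min (V x) N * J.generator V x + J.rateBound * (δ ^ 2 / 2) := by
  have hsq : ∀ t, (V (J.target t x) - V x) ^ 2 / 2 ≤ δ ^ 2 / 2 := fun t => by
    have := sq_le_sq' (abs_le.1 (hδ t x)).1 (abs_le.1 (hδ t x)).2
    linarith
  refine le_trans ?_ (add_le_add_right (J.sum_rate_mul_le (by positivity) hsq x) _)
  simp only [generator_apply, Finset.mul_sum, ← Finset.sum_add_distrib]
  refine Finset.sum_le_sum fun t _ => ?_
  have := mul_le_mul_of_nonneg_left (huber_sub_le N (V x) (V (J.target t x))) (J.rate_nonneg t x)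
  linarith

theorem mul_min_add_generator_huber_le {V : X → ℝ} {δ ε a N : ℝ} (hV : 0 ≤ V)
    (hδ : ∀ t x, |V (J.target t x) - V x| ≤ δ) (hε : 0 < ε)
    (hdrift : ∀ x, a < V x → J.generator V x ≤ -ε) (hN : 0 ≤ N) (x : X) :
    ε * min (V x) N + J.generator (fun y => huber N (V y)) x
      ≤ |a| * (J.rateBound * |δ| + ε) + J.rateBound * (δ ^ 2 / 2) := by
  have hmin : 0 ≤ min (V x) N := le_min (hV x) hN
  have habs : |J.generator V x| ≤ J.rateBound * |δ| :=
    J.abs_generator_le (abs_nonneg δ) fun t => (hδ t x).trans (le_abs_self δ)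
  have hbound : 0 ≤ J.rateBound * |δ| + ε := by linarith [abs_nonneg (J.generator V x)]
  suffices min (V x) N * (J.generator V x + ε) ≤ |a| * (J.rateBound * |δ| + ε) by
    linarith [J.generator_huber_le hδ N x]
  rcases lt_or_ge a (V x) with ha | ha
  · have hneg : J.generator V x + ε ≤ 0 := by linarith [hdrift x ha]
    exact (mul_nonpos_of_nonneg_of_nonpos hmin hneg).trans (mul_nonneg (abs_nonneg a) hbound)
  · calc min (V x) N * (J.generator V x + ε) ≤ min (V x) N * (J.rateBound * |δ| + ε) :=
          mul_le_mul_of_nonneg_left (by linarith [le_abs_self (J.generator V x)]) hmin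
      _ ≤ |a| * (J.rateBound * |δ| + ε) :=
          mul_le_mul_of_nonneg_right ((min_le_left _ _).trans (ha.trans (le_abs_self a))) hbound

variable [MeasurableSpace X] {ν : Measure X}

/-- Infinitesimal invariance of `ν`: the generator integrates to zero on bounded functions. -/
def IsInvariant (ν : Measure X) : Prop :=
  ∀ (f : X → ℝ) (C : ℝ), (∀ x, |f x| ≤ C) → ∫ x, J.generator f x ∂ν = 0

variable {J} [DiscreteMeasurableSpace X]

/-- The truncations of `f` to `[-N, N]` are bounded and have smaller increments than `f`, so that
dominated convergence applies. -/
theorem IsInvariant.integral_generator_eq_zero (hν : J.IsInvariant ν) {f B : X → ℝ}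
    (hB : Integrable B ν) (hf : ∀ t x, |f (J.target t x) - f x| ≤ B x) :
    ∫ x, J.generator f x ∂ν = 0 := by
  rcases isEmpty_or_nonempty T with _ | ⟨⟨t₀⟩⟩
  · simp [generator_apply]
  have hB₀ : ∀ x, 0 ≤ B x := fun x => (abs_nonneg _).trans (hf t₀ x)
  let trunc : ℕ → X → ℝ := fun N x => max (min (f x) N) (-N)
  have htrunc : ∀ (N : ℕ) t x, |trunc N (J.target t x) - trunc N x| ≤ B x := fun N t x =>
    (abs_max_sub_max_le_abs _ _ _).trans ((abs_min_sub_min_le_max _ _ _ _).trans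
      (max_le (hf t x) (by simpa using hB₀ x)))
  have hbdd : ∀ (N : ℕ) x, |trunc N x| ≤ N := fun N x =>
    abs_le.2 ⟨le_max_right _ _, max_le (min_le_right _ _) (by simp)⟩
  have hlim : ∀ x, Filter.Tendsto (trunc · x) Filter.atTop (nhds (f x)) := fun x =>
    tendsto_const_nhds.congr' <| (Filter.eventually_ge_atTop ⌈|f x|⌉₊).mono fun N hN => by
      have h := abs_le.1 (Nat.ceil_le.1 hN)
      simp only [trunc, min_eq_left h.2, max_eq_left h.1]
  have hgen : Filter.Tendsto (fun N => ∫ x, J.generator (trunc N) x ∂ν) Filter.atTop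
      (nhds (∫ x, J.generator f x ∂ν)) :=
    tendsto_integral_of_dominated_convergence (fun x => J.rateBound * B x)
      (fun N => Measurable.of_discrete.aestronglyMeasurable) (hB.const_mul _)
      (fun N => ae_of_all _ fun x => J.abs_generator_le (hB₀ x) (htrunc N · x))
      (ae_of_all _ fun x => tendsto_finsetSum _ fun t _ =>
        ((hlim _).sub (hlim x)).const_mul (J.rate t x))
  refine tendsto_nhds_unique hgen ?_
  simp only [hν (trunc _) _ (hbdd _), tendsto_const_nhds]

theorem IsInvariant.integral_mul_generator_add [IsFiniteMeasure ν] (hν : J.IsInvariant ν)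
    {f g : X → ℝ} {a b : ℝ} (hf : Integrable f ν) (hg : Integrable g ν)
    (hfa : ∀ t x, |f (J.target t x) - f x| ≤ a) (hgb : ∀ t x, |g (J.target t x) - g x| ≤ b) :
    ∫ x, f x * J.generator g x ∂ν + ∫ x, g x * J.generator f x ∂ν
      + ∫ x, J.carreDuChamp f g x ∂ν = 0 := by
  have hΓ : ∀ t x, |(f (J.target t x) - f x) * (g (J.target t x) - g x)| ≤ |a| * |b| :=
    fun t x => by
      rw [abs_mul]
      exact mul_le_mul ((hfa t x).trans (le_abs_self a)) ((hgb t x).trans (le_abs_self b))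
        (abs_nonneg _) (abs_nonneg a)
  have hfg : ∀ t x, |(f * g) (J.target t x) - (f * g) x| ≤ |f x| * b + |g x| * a + |a| * |b| :=
    fun t x => by
      have hprod : (f * g) (J.target t x) - (f * g) x
          = f x * (g (J.target t x) - g x) + g x * (f (J.target t x) - f x)
            + (f (J.target t x) - f x) * (g (J.target t x) - g x) := by
        simp only [Pi.mul_apply]
        ring
      rw [hprod]
      refine (abs_add_three _ _ _).trans (add_le_add_three ?_ ?_ (hΓ t x)) <;> rw [abs_mul]
      · exact mul_le_mul_of_nonneg_left (hgb t x) (abs_nonneg _)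
      · exact mul_le_mul_of_nonneg_left (hfa t x) (abs_nonneg _)
  have hmul : ∀ {u v : X → ℝ} {c : ℝ}, Integrable u ν →
      (∀ t x, |v (J.target t x) - v x| ≤ c) → Integrable (fun x => u x * J.generator v x) ν :=
    fun hu hv => hu.mul_bdd Measurable.of_discrete.aestronglyMeasurable (ae_of_all _ fun x =>
      J.abs_generator_le (abs_nonneg _) fun t => (hv t x).trans (le_abs_self _))
  have hcarre : Integrable (J.carreDuChamp f g) ν := integrable_of_abs_le fun x =>
    J.abs_sum_rate_mul_le (by positivity) (hΓ · x)
  rw [← integral_add (hmul hf hgb) (hmul hg hfa),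
    ← integral_add (f := fun x => f x * J.generator g x + g x * J.generator f x)
      ((hmul hf hgb).add (hmul hg hfa)) hcarre]
  have hzero := hν.integral_generator_eq_zero (f := f * g)
    (((hf.abs.mul_const b).add (hg.abs.mul_const a)).add (integrable_const _)) hfg
  rwa [J.generator_mul] at hzero

/-- Test the invariance on the indicator of the target state. -/
theorem IsInvariant.measure_singleton_target_ne_zero [IsFiniteMeasure ν] (hν : J.IsInvariant ν)
    {t : T} {x : X} (ht : 0 < J.rate t x) (hx : ν {x} ≠ 0) : ν {J.target t x} ≠ 0 := by
  intro hy
  let f : X → ℝ := Set.indicator {J.target t x} 1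
  have hf₀ : ∀ z, 0 ≤ f z := fun z => Set.indicator_nonneg (fun _ _ => zero_le_one) z
  have hf₁ : ∀ z, |f z| ≤ 1 := fun z => by
    rw [abs_of_nonneg (hf₀ z)]
    exact Set.indicator_le_self' (fun _ _ => zero_le_one) z
  have hf : ∀ z ≠ J.target t x, f z = 0 := fun z hz =>
    Set.indicator_of_notMem (s := {J.target t x}) hz _
  have hterm : ∀ z ≠ J.target t x, ∀ s, 0 ≤ J.rate s z * (f (J.target s z) - f z) :=
    fun z hz s => by
      rw [hf z hz, sub_zero]
      exact mul_nonneg (J.rate_nonneg s z) (hf₀ _)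
  have hne : x ≠ J.target t x := fun h => hx (h ▸ hy)
  have hpos : 0 < J.generator f x :=
    (by simpa [f, hf x hne] using ht : 0 < J.rate t x * (f (J.target t x) - f x)).trans_le
      (Finset.single_le_sum (fun s _ => hterm x hne s) (Finset.mem_univ t))
  have hnonneg : 0 ≤ᵐ[ν] J.generator f := by
    filter_upwards [measure_eq_zero_iff_ae_notMem.1 hy] with z hz
    exact Finset.sum_nonneg fun s _ => hterm z hz s
  have hint : Integrable (J.generator f) ν := integrable_of_abs_le fun z =>
    J.abs_generator_le zero_le_two fun s =>
      (abs_sub _ _).trans (by linarith [hf₁ (J.target s z), hf₁ z])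
  exact (integral_pos_of_measure_singleton_ne_zero hnonneg hint hpos hx).ne' (hν f 1 hf₁)

/-- Foster–Lyapunov criterion. Invariance on the Huber functions of `V` bounds the integrals of
`min V N` uniformly in `N`. -/
theorem IsInvariant.integrable_of_drift [IsFiniteMeasure ν] (hν : J.IsInvariant ν) {V : X → ℝ}
    {δ ε a : ℝ} (hV : 0 ≤ V) (hδ : ∀ t x, |V (J.target t x) - V x| ≤ δ) (hε : 0 < ε)
    (hdrift : ∀ x, a < V x → J.generator V x ≤ -ε) : Integrable V ν := by
  let C := |a| * (J.rateBound * |δ| + ε) + J.rateBound * (δ ^ 2 / 2)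
  refine integrable_of_integral_min_natCast_le (C := ν.real Set.univ * C / ε)
    Measurable.of_discrete hV fun N => ?_
  have hincr : ∀ t x, |huber N (V (J.target t x)) - huber N (V x)| ≤ N * |δ| + δ ^ 2 / 2 :=
    fun t x => by
      have hN := mul_le_mul_of_nonneg_left ((hδ t x).trans (le_abs_self δ)) (Nat.cast_nonneg N)
      have hsq := sq_le_sq' (abs_le.1 (hδ t x)).1 (abs_le.1 (hδ t x)).2
      linarith [abs_huber_sub_le (Nat.cast_nonneg N) (hV x) (hV (J.target t x))]
  have hmin : Integrable (fun x => ε * min (V x) N) ν :=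
    (integrable_of_abs_le (C := N) fun x => by
      rw [abs_of_nonneg (le_min (hV x) N.cast_nonneg)]
      exact min_le_right _ _).const_mul ε
  have hhuber : Integrable (J.generator fun y => huber N (V y)) ν :=
    integrable_of_abs_le fun x => J.abs_generator_le (by positivity) (hincr · x)
  rw [le_div_iff₀' hε]
  calc ε * ∫ x, min (V x) N ∂ν
      = ∫ x, (ε * min (V x) N + J.generator (fun y => huber N (V y)) x) ∂ν := by
        rw [integral_add hmin hhuber, integral_const_mul,
          hν.integral_generator_eq_zero (integrable_const _) hincr, add_zero]
    _ ≤ ∫ _, C ∂ν := integral_mono (hmin.add hhuber) (integrable_const C)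
        (J.mul_min_add_generator_huber_le hV hδ hε hdrift N.cast_nonneg)
    _ = ν.real Set.univ * C := by rw [integral_const, smul_eq_mul]

end JumpRates

/-! ### Uniformly continuous semigroups -/

theorem map_eq_zero_of_expSemigroup_invariant {E F : Type*} [NormedAddCommGroup E]
    [NormedSpace ℝ E] [CompleteSpace E] [NormedAddCommGroup F] [NormedSpace ℝ F] (A : E →L[ℝ] E)
    (φ : E →L[ℝ] F) (x : E) (h : ∀ t, 0 ≤ t → φ (expSemigroup A t x) = φ x) : φ (A x) = 0 := by
  have hsemigroup : HasDerivAt (expSemigroup A) A 0 := by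
    have h := hasDerivAt_exp_smul_const (𝕂 := ℝ) A (0 : ℝ)
    rwa [zero_smul, NormedSpace.exp_zero, one_mul] at h
  have hright : HasDerivWithinAt (fun t => φ (expSemigroup A t x)) (φ (A x)) (Set.Ici 0) 0 := by
    simpa [Function.comp_def] using (φ.hasFDerivAt.comp_hasDerivAt (0 : ℝ)
      (hsemigroup.clm_apply (hasDerivAt_const (0 : ℝ) x))).hasDerivWithinAt
  exact (uniqueDiffOn_Ici (0 : ℝ) 0 Set.self_mem_Ici).eq_deriv _ hright
    ((hasDerivWithinAt_const 0 _ (φ x)).congr (fun t ht => h t ht) (h 0 le_rfl))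

/-! ### The modulated queue as a jump process -/

namespace ModulatedDPS

variable {K D : ℕ} (S : ModulatedDPS K D)

theorem isIrreducibleGenerator : IsIrreducibleGenerator S.Q :=
  ⟨S.Q_offDiag_nonneg, S.Q_row_sum, S.Q_irreducible⟩

theorem arrivalRate_nonneg (k : Fin K) (d : Fin D) : 0 ≤ S.arrivalRate k d :=
  mul_nonneg (S.alpha_nonneg k d) (S.lam_nonneg d)

theorem serviceRate_nonneg (k : Fin K) (d : Fin D) : 0 ≤ S.serviceRate k d :=
  mul_nonneg (S.mu_pos k).le (S.c_nonneg d)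

/-- The transitions of `(M, Z)`: arrivals and departures, indexed by the class of the customer, and
changes of the environment, indexed by the new environment state. -/
noncomputable def jumps : JumpRates (Fin K ⊕ Fin K ⊕ Fin D) ((Fin K → ℕ) × Fin D) where
  rate := Sum.elim (fun k x => S.arrivalRate k x.2)
    (Sum.elim (fun k x => S.serviceRate k x.2 * S.share k x.1)
      fun l x => if x.2 = l then 0 else S.Q x.2 l)
  target := Sum.elim (fun k x => (x.1 + Pi.single k 1, x.2))
    (Sum.elim (fun k x => (x.1 - Pi.single k 1, x.2)) fun l x => (x.1, l))
  rateBound := S.rateBound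
  rate_nonneg := by
    rintro (k | k | l) x
    · exact S.arrivalRate_nonneg k x.2
    · exact mul_nonneg (S.serviceRate_nonneg k x.2) (S.share_nonneg k x.1)
    · simp only [Sum.elim_inr]
      split_ifs with h
      · exact le_rfl
      · exact S.Q_offDiag_nonneg x.2 l h
  sum_rate_le x := by
    refine le_trans ?_ (Finset.single_le_sum (f := fun d => ∑ k, |S.arrivalRate k d|
      + ∑ k, |S.serviceRate k d| + ∑ l, |S.Q d l|) (fun d _ => by positivity)
      (Finset.mem_univ x.2))
    simp only [Fintype.sum_sum_type, Sum.elim_inl, Sum.elim_inr, ← add_assoc]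
    refine add_le_add_three (Finset.sum_le_sum fun k _ => le_abs_self _)
      (Finset.sum_le_sum fun k _ => ?_) (Finset.sum_le_sum fun l _ => ?_)
    · exact (mul_le_of_le_one_right (S.serviceRate_nonneg k x.2) (S.share_le_one k x.1)).trans
        (le_abs_self _)
    · split_ifs
      · exact abs_nonneg _
      · exact le_abs_self _

theorem jumps_generator (f : (Fin K → ℕ) × Fin D → ℝ) : S.jumps.generator f = S.generatorFun f := by
  ext x
  have henv : ∀ l, (if x.2 = l then 0 else S.Q x.2 l) * (f (x.1, l) - f x)
      = S.Q x.2 l * (f (x.1, l) - f x) := fun l => by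
    split_ifs with h
    · simp [← h]
    · rfl
  simp only [JumpRates.generator_apply, jumps, Fintype.sum_sum_type, Sum.elim_inl, Sum.elim_inr,
    henv, generatorFun, add_assoc]

variable {S} {ν : Measure ((Fin K → ℕ) × Fin D)} {p : Fin D → ℝ}

theorem IsSteadyState.isInvariant (hν : S.IsSteadyState ν) : S.jumps.IsInvariant ν := by
  intro f C hf
  have := hν.1
  let I : ((Fin K → ℕ) × Fin D →ᵇ ℝ) →L[ℝ] ℝ := LinearMap.mkContinuous
    { toFun := fun g => ∫ x, g x ∂ν
      map_add' := fun g h => integral_add (g.integrable ν) (h.integrable ν)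
      map_smul' := fun a g => integral_const_mul a g } 1 fun g => by
        simpa using g.norm_integral_le_norm (μ := ν)
  rw [jumps_generator]
  exact map_eq_zero_of_expSemigroup_invariant S.generator I
    (BoundedContinuousFunction.ofNormedAddCommGroupDiscrete f C hf) fun t ht => hν.2 t ht _

variable (S)

/-- The number of class-`k` customers, as a real-valued function of the state. -/
def queueLength (k : Fin K) (x : (Fin K → ℕ) × Fin D) : ℝ := x.1 k

theorem queueLength_nonneg (k : Fin K) (x : (Fin K → ℕ) × Fin D) : 0 ≤ queueLength k x :=
  Nat.cast_nonneg _

theorem share_eq_zero {k : Fin K} {m : Fin K → ℕ} (h : m k = 0) : S.share k m = 0 := by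
  simp [share, h]

/-- The change of the number of class-`k` customers in a transition that occurs at positive rate. -/
def increment (k : Fin K) : Fin K ⊕ Fin K ⊕ Fin D → ℝ :=
  Sum.elim (fun i => if k = i then 1 else 0) (Sum.elim (fun i => if k = i then -1 else 0) 0)

theorem queueLength_target_sub {t : Fin K ⊕ Fin K ⊕ Fin D} {x : (Fin K → ℕ) × Fin D}
    (h : S.jumps.rate t x ≠ 0) (k : Fin K) :
    queueLength k (S.jumps.target t x) - queueLength k x = increment k t := by
  obtain i | i | l := t
  · rcases eq_or_ne k i with rfl | hk
    · simp [jumps, queueLength, increment]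
    · simp [jumps, queueLength, increment, hk]
  · have hi : x.1 i ≠ 0 := fun hi => h (by simp [jumps, S.share_eq_zero hi])
    rcases eq_or_ne k i with rfl | hk
    · simp [jumps, queueLength, increment, Nat.cast_sub (Nat.one_le_iff_ne_zero.2 hi)]
    · simp [jumps, queueLength, increment, hk]
  · simp [jumps, queueLength, increment]

theorem abs_queueLength_target_sub_le (k : Fin K) (t : Fin K ⊕ Fin K ⊕ Fin D)
    (x : (Fin K → ℕ) × Fin D) :
    |queueLength k (S.jumps.target t x) - queueLength k x| ≤ 1 := by
  obtain i | i | l := t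
  · rcases eq_or_ne k i with rfl | hk
    · simp [jumps, queueLength]
    · simp [jumps, queueLength, hk]
  · rcases eq_or_ne k i with rfl | hk
    · rcases Nat.eq_zero_or_pos (x.1 k) with hx | hx
      · simp [jumps, queueLength, hx]
      · simp [jumps, queueLength, Nat.cast_sub hx]
    · simp [jumps, queueLength, hk]
  · simp [jumps, queueLength]

theorem generator_queueLength (k : Fin K) (x : (Fin K → ℕ) × Fin D) :
    S.jumps.generator (queueLength k) x
      = S.arrivalRate k x.2 - S.serviceRate k x.2 * S.share k x.1 := by
  have hterm : ∀ t, S.jumps.rate t x * (queueLength k (S.jumps.target t x) - queueLength k x)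
      = S.jumps.rate t x * increment k t := fun t =>
    mul_eq_mul_left_iff.2 (or_iff_not_imp_right.2 fun h => S.queueLength_target_sub h k)
  simp only [JumpRates.generator_apply, hterm]
  simp [jumps, increment, sub_eq_add_neg]

theorem carreDuChamp_queueLength (j k : Fin K) (x : (Fin K → ℕ) × Fin D) :
    S.jumps.carreDuChamp (queueLength j) (queueLength k) x
      = if j = k then S.arrivalRate k x.2 + S.serviceRate k x.2 * S.share k x.1 else 0 := by
  have hterm : ∀ t, S.jumps.rate t x * ((queueLength j (S.jumps.target t x) - queueLength j x)
      * (queueLength k (S.jumps.target t x) - queueLength k x))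
      = S.jumps.rate t x * (increment j t * increment k t) := fun t =>
    mul_eq_mul_left_iff.2 (or_iff_not_imp_right.2 fun h => by
      rw [S.queueLength_target_sub h, S.queueLength_target_sub h])
  simp only [JumpRates.carreDuChamp, hterm]
  rcases eq_or_ne j k with rfl | hjk
  · simp [jumps, increment]
  · simp [jumps, increment, hjk]

theorem generator_environment (h : Fin D → ℝ) (x : (Fin K → ℕ) × Fin D) :
    S.jumps.generator (fun y => h y.2) x = (S.Q *ᵥ h) x.2 := by
  simp [jumps_generator, generatorFun, S.isIrreducibleGenerator.mulVec_apply_eq_sum_sub]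

/-! ### Rate conservation -/

theorem sum_g_mul_pos {m : Fin K → ℕ} (h : m ≠ 0) : 0 < ∑ j, S.g j * (m j : ℝ) := by
  obtain ⟨k, hk⟩ := Function.ne_iff.1 h
  exact Finset.sum_pos' (fun j _ => mul_nonneg (S.g_pos j).le (Nat.cast_nonneg _))
    ⟨k, Finset.mem_univ k, mul_pos (S.g_pos k) (Nat.cast_pos.2 (Nat.pos_of_ne_zero hk))⟩

theorem sum_share {m : Fin K → ℕ} (h : m ≠ 0) : ∑ k, S.share k m = 1 := by
  simp only [share, ← Finset.sum_div]
  exact div_self (S.sum_g_mul_pos h).ne'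

theorem abs_share_le_one (k : Fin K) (m : Fin K → ℕ) : |S.share k m| ≤ 1 := by
  rw [abs_of_nonneg (S.share_nonneg k m)]
  exact S.share_le_one k m

theorem avgArrivalRate_eq_dotProduct (p : Fin D → ℝ) (k : Fin K) :
    S.avgArrivalRate p k = p ⬝ᵥ S.arrivalRate k :=
  Finset.sum_congr rfl fun _ _ => mul_comm _ _

/-- The work that arrives per unit of time in environment state `d`, in units of service. -/
noncomputable def load (d : Fin D) : ℝ := ∑ k, (S.mu k)⁻¹ * S.arrivalRate k d

/-- The expected time that a server of unit capacity needs for the customers that are present. -/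
noncomputable def workload (x : (Fin K → ℕ) × Fin D) : ℝ := ∑ k, (S.mu k)⁻¹ * queueLength k x

/-- The capacity that is lost because the queue is empty. -/
def idleCapacity (x : (Fin K → ℕ) × Fin D) : ℝ := if x.1 = 0 then S.c x.2 else 0

theorem idleCapacity_nonneg (x : (Fin K → ℕ) × Fin D) : 0 ≤ S.idleCapacity x := by
  unfold idleCapacity
  split_ifs
  exacts [S.c_nonneg _, le_rfl]

theorem workload_nonneg (x : (Fin K → ℕ) × Fin D) : 0 ≤ S.workload x :=
  Finset.sum_nonneg fun k _ => mul_nonneg (inv_pos.2 (S.mu_pos k)).le (queueLength_nonneg k x)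

theorem abs_workload_target_sub_le (t : Fin K ⊕ Fin K ⊕ Fin D) (x : (Fin K → ℕ) × Fin D) :
    |S.workload (S.jumps.target t x) - S.workload x| ≤ ∑ k, (S.mu k)⁻¹ := by
  simp only [workload, ← Finset.sum_sub_distrib, ← mul_sub]
  refine (Finset.abs_sum_le_sum_abs _ _).trans (Finset.sum_le_sum fun k _ => ?_)
  have hmu := (inv_pos.2 (S.mu_pos k)).le
  rw [abs_mul, abs_of_nonneg hmu]
  exact mul_le_of_le_one_right hmu (S.abs_queueLength_target_sub_le k t x)

theorem generator_workload (x : (Fin K → ℕ) × Fin D) :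
    S.jumps.generator S.workload x = S.idleCapacity x - (S.c - S.load) x.2 := by
  have hworkload : S.workload = ∑ k, (S.mu k)⁻¹ • queueLength k := by
    ext x
    simp [workload]
  have hservice : ∀ k, (S.mu k)⁻¹ * (S.serviceRate k x.2 * S.share k x.1)
      = S.c x.2 * S.share k x.1 := fun k => by
    have := (S.mu_pos k).ne'
    simp only [serviceRate]
    field_simp
  simp only [hworkload, map_sum, map_smul, Finset.sum_apply, Pi.smul_apply, smul_eq_mul,
    generator_queueLength, mul_sub, hservice, Finset.sum_sub_distrib, ← Finset.mul_sum, load,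
    Pi.sub_apply, idleCapacity]
  split_ifs with h
  · simp [h, S.share_eq_zero]
  · rw [S.sum_share h]
    ring

variable {S}

theorem IsInvariantEnv.ne_zero (hp : S.IsInvariantEnv p) : p ≠ 0 := by
  rintro rfl
  simpa using hp.2.1

theorem IsInvariantEnv.exists_mulVec_eq_sub (hp : S.IsInvariantEnv p) (u : Fin D → ℝ) :
    ∃ h, 0 ≤ h ∧ ∀ d, (S.Q *ᵥ h) d = u d - p ⬝ᵥ u := by
  have hcentred : p ⬝ᵥ (u - fun _ => p ⬝ᵥ u) = 0 := by
    rw [dotProduct_sub]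
    simp only [dotProduct, ← Finset.sum_mul, hp.2.1, one_mul, sub_self]
  obtain ⟨h, hh₀, hh⟩ :=
    S.isIrreducibleGenerator.exists_nonneg_mulVec_eq hp.2.2 hp.ne_zero hcentred
  exact ⟨h, hh₀, congrFun hh⟩

theorem IsInvariantEnv.avgArrivalRate_pos (hp : S.IsInvariantEnv p) (k : Fin K) :
    0 < S.avgArrivalRate p k := by
  have hpos := S.isIrreducibleGenerator.pos_of_vecMul_eq_zero hp.2.2 hp.1 hp.ne_zero
  obtain ⟨d, hd⟩ := S.exists_arrival_pos k
  exact Finset.sum_pos' (fun d _ => mul_nonneg (S.arrivalRate_nonneg k d) (hpos d).le)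
    ⟨d, Finset.mem_univ d, mul_pos hd (hpos d)⟩

theorem integrable_environment [IsFiniteMeasure ν] (u : Fin D → ℝ) :
    Integrable (fun x => u x.2) ν :=
  integrable_of_abs_le fun x => norm_le_pi_norm u x.2

theorem integrable_environment_mul {F : (Fin K → ℕ) × Fin D → ℝ} (hF : Integrable F ν)
    (u : Fin D → ℝ) : Integrable (fun x => u x.2 * F x) ν :=
  hF.bdd_mul Measurable.of_discrete.aestronglyMeasurable
    (ae_of_all _ fun x => norm_le_pi_norm u x.2)

theorem integrable_share [IsFiniteMeasure ν] (k : Fin K) :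
    Integrable (fun x => S.share k x.1) ν :=
  integrable_of_abs_le fun x => S.abs_share_le_one k x.1

theorem integrable_idleCapacity [IsFiniteMeasure ν] : Integrable S.idleCapacity ν :=
  integrable_of_abs_le (C := ‖S.c‖) fun x => by
    unfold idleCapacity
    split_ifs
    · exact norm_le_pi_norm S.c x.2
    · simp

/-- Integrate the Poisson equation `Q h = u - p ⬝ᵥ u`. -/
theorem IsSteadyState.integral_environment (hν : S.IsSteadyState ν) (hp : S.IsInvariantEnv p)
    (u : Fin D → ℝ) : ∫ x, u x.2 ∂ν = p ⬝ᵥ u := by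
  have := hν.1
  obtain ⟨h, -, hh⟩ := hp.exists_mulVec_eq_sub u
  have hzero := hν.isInvariant (fun x => h x.2) ‖h‖ fun x => norm_le_pi_norm h x.2
  simp only [generator_environment, hh] at hzero
  rw [integral_sub (integrable_environment u) (integrable_const _), integral_const, probReal_univ,
    one_smul] at hzero
  exact sub_eq_zero.1 hzero

theorem IsSteadyState.integral_serviceRate_mul_share (hν : S.IsSteadyState ν)
    (hp : S.IsInvariantEnv p) (k : Fin K) :
    ∫ x, S.serviceRate k x.2 * S.share k x.1 ∂ν = S.avgArrivalRate p k := by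
  have := hν.1
  have hzero := hν.isInvariant.integral_generator_eq_zero (integrable_const 1)
    (S.abs_queueLength_target_sub_le k)
  simp only [generator_queueLength] at hzero
  rw [integral_sub (integrable_environment _)
    (integrable_environment_mul (integrable_share k) _), hν.integral_environment hp,
    ← avgArrivalRate_eq_dotProduct] at hzero
  linarith

theorem IsSteadyState.integral_idleCapacity (hν : S.IsSteadyState ν) (hp : S.IsInvariantEnv p) :
    ∫ x, S.idleCapacity x ∂ν = p ⬝ᵥ (S.c - S.load) := by
  have := hν.1
  have hzero := hν.isInvariant.integral_generator_eq_zero (integrable_const _)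
    S.abs_workload_target_sub_le
  simp only [generator_workload] at hzero
  rw [integral_sub integrable_idleCapacity (integrable_environment _),
    hν.integral_environment hp] at hzero
  linarith

/-! ### Finiteness of the mean queue lengths -/

theorem share_pos {k : Fin K} {m : Fin K → ℕ} (h : m k ≠ 0) : 0 < S.share k m :=
  div_pos (mul_pos (S.g_pos k) (Nat.cast_pos.2 (Nat.pos_of_ne_zero h)))
    (S.sum_g_mul_pos fun hm => h (congrFun hm k))

theorem IsSteadyState.measure_empty_ne_zero (hν : S.IsSteadyState ν) {d : Fin D}
    (hd : 0 < S.c d) (m : Fin K → ℕ) (hm : ν {(m, d)} ≠ 0) : ν {(0, d)} ≠ 0 := by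
  have := hν.1
  induction m using WellFoundedLT.induction with
  | ind m ih =>
    by_cases h : m = 0
    · rwa [← h]
    · obtain ⟨k, hk⟩ := Function.ne_iff.1 h
      refine ih (m - Pi.single k 1) ?_ (hν.isInvariant.measure_singleton_target_ne_zero
        (t := Sum.inr (Sum.inl k)) (mul_pos (mul_pos (S.mu_pos k) hd) (S.share_pos hk)) hm)
      refine Pi.lt_def.2 ⟨tsub_le_self, k, ?_⟩
      simpa using Nat.pos_of_ne_zero hk

/-- Customers of class `k` leave at a positive rate, so that the server is active in some state
that is charged by `ν`; from there the queue empties with positive probability. -/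
theorem IsSteadyState.dotProduct_capacity_sub_load_pos (hν : S.IsSteadyState ν)
    (hp : S.IsInvariantEnv p) (k : Fin K) : 0 < p ⬝ᵥ (S.c - S.load) := by
  have := hν.1
  obtain ⟨⟨m, d⟩, hcharged, hc⟩ : ∃ x : (Fin K → ℕ) × Fin D, ν {x} ≠ 0 ∧ S.c x.2 ≠ 0 := by
    by_contra! h
    have hidle : ∀ᵐ x ∂ν, S.serviceRate k x.2 * S.share k x.1 = 0 :=
      ae_iff_of_countable.2 fun x hx => by rw [serviceRate, h x hx, mul_zero, zero_mul]
    refine (hp.avgArrivalRate_pos k).ne' ?_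
    rw [← hν.integral_serviceRate_mul_share hp, integral_eq_zero_of_ae hidle]
  have hd : 0 < S.c d := (S.c_nonneg d).lt_of_ne' hc
  rw [← hν.integral_idleCapacity hp]
  refine integral_pos_of_measure_singleton_ne_zero (ae_of_all _ S.idleCapacity_nonneg)
    integrable_idleCapacity (x := (0, d)) ?_ (hν.measure_empty_ne_zero hd m hcharged)
  simpa [idleCapacity] using hd

/-- With `Q h = (S.c - S.load) - ε`, the function `workload + h` has drift `-ε` off the empty
queue. -/
theorem IsSteadyState.integrable_workload (hν : S.IsSteadyState ν) (hp : S.IsInvariantEnv p)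
    (k : Fin K) : Integrable S.workload ν := by
  have := hν.1
  have hε := hν.dotProduct_capacity_sub_load_pos hp k
  obtain ⟨h, hh₀, hh⟩ := hp.exists_mulVec_eq_sub (S.c - S.load)
  have hbound : ∀ x : (Fin K → ℕ) × Fin D, |h x.2| ≤ ‖h‖ := fun x => norm_le_pi_norm h x.2
  let V : (Fin K → ℕ) × Fin D → ℝ := S.workload + fun x => h x.2
  have hV : 0 ≤ V := fun x => add_nonneg (S.workload_nonneg x) (hh₀ x.2)
  have hincr : ∀ t x, |V (S.jumps.target t x) - V x| ≤ ∑ k, (S.mu k)⁻¹ + 2 * ‖h‖ := fun t x => by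
    have hsplit : V (S.jumps.target t x) - V x = (S.workload (S.jumps.target t x) - S.workload x)
        + (h (S.jumps.target t x).2 - h x.2) := add_sub_add_comm _ _ _ _
    rw [hsplit]
    linarith [abs_add_le (S.workload (S.jumps.target t x) - S.workload x)
      (h (S.jumps.target t x).2 - h x.2), abs_sub (h (S.jumps.target t x).2) (h x.2),
      S.abs_workload_target_sub_le t x, hbound (S.jumps.target t x), hbound x]
  have hdrift : ∀ x, ‖h‖ < V x → S.jumps.generator V x ≤ -(p ⬝ᵥ (S.c - S.load)) := fun x hx => by
    have hx₀ : x.1 ≠ 0 := fun hx₀ => by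
      have hV₀ : V x = h x.2 := by simp [V, workload, queueLength, hx₀]
      linarith [le_abs_self (h x.2), hbound x]
    rw [map_add, Pi.add_apply, generator_workload, generator_environment, hh, idleCapacity,
      if_neg hx₀]
    linarith
  refine (hν.isInvariant.integrable_of_drift hV hincr hε hdrift).mono'
    Measurable.of_discrete.aestronglyMeasurable (ae_of_all _ fun x => ?_)
  rw [Real.norm_eq_abs, abs_of_nonneg (S.workload_nonneg x)]
  exact le_add_of_nonneg_right (hh₀ x.2)

theorem IsSteadyState.integrable_queueLength (hν : S.IsSteadyState ν) (hp : S.IsInvariantEnv p)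
    (k : Fin K) : Integrable (queueLength k) ν := by
  refine ((hν.integrable_workload hp k).const_mul (S.mu k)).mono'
    Measurable.of_discrete.aestronglyMeasurable (ae_of_all _ fun x => ?_)
  rw [Real.norm_eq_abs, abs_of_nonneg (queueLength_nonneg k x), ← inv_mul_le_iff₀ (S.mu_pos k)]
  exact Finset.single_le_sum (f := fun k => (S.mu k)⁻¹ * queueLength k x)
    (fun k _ => mul_nonneg (inv_pos.2 (S.mu_pos k)).le (queueLength_nonneg k x))
    (Finset.mem_univ k)

/-! ### Second moments -/

theorem integrable_share_mul {F : (Fin K → ℕ) × Fin D → ℝ} (hF : Integrable F ν) (k : Fin K) :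
    Integrable (fun x => S.share k x.1 * F x) ν :=
  hF.bdd_mul Measurable.of_discrete.aestronglyMeasurable
    (ae_of_all _ fun x => S.abs_share_le_one k x.1)

theorem integral_mul_generator_queueLength {F : (Fin K → ℕ) × Fin D → ℝ} (hF : Integrable F ν)
    (k : Fin K) :
    ∫ x, F x * S.jumps.generator (queueLength k) x ∂ν
      = ∫ x, S.arrivalRate k x.2 * F x ∂ν
        - ∫ x, S.serviceRate k x.2 * (S.share k x.1 * F x) ∂ν := by
  rw [← integral_sub (integrable_environment_mul hF _)
    (integrable_environment_mul (integrable_share_mul hF k) _)]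
  refine integral_congr_ae (ae_of_all _ fun x => ?_)
  simp only [generator_queueLength]
  ring

theorem IsSteadyState.integral_carreDuChamp_queueLength (hν : S.IsSteadyState ν)
    (hp : S.IsInvariantEnv p) (j k : Fin K) :
    ∫ x, S.jumps.carreDuChamp (queueLength j) (queueLength k) x ∂ν
      = if j = k then 2 * S.avgArrivalRate p k else 0 := by
  have := hν.1
  simp only [carreDuChamp_queueLength]
  split_ifs
  · rw [integral_add (integrable_environment _) (integrable_environment_mul (integrable_share k) _),
      hν.integral_environment hp, ← avgArrivalRate_eq_dotProduct,
      hν.integral_serviceRate_mul_share hp, two_mul]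
  · exact integral_zero _ _

theorem IsSteadyState.second_moment_balance (hν : S.IsSteadyState ν) (hp : S.IsInvariantEnv p)
    (j k : Fin K) :
    ∫ x, S.serviceRate j x.2 * (S.share j x.1 * queueLength k x) ∂ν
        + ∫ x, S.serviceRate k x.2 * (S.share k x.1 * queueLength j x) ∂ν =
      ∫ x, S.arrivalRate j x.2 * queueLength k x ∂ν
        + ∫ x, S.arrivalRate k x.2 * queueLength j x ∂ν
        + if j = k then 2 * S.avgArrivalRate p k else 0 := by
  have := hν.1
  have hj := hν.integrable_queueLength hp j
  have hk := hν.integrable_queueLength hp k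
  have hzero := hν.isInvariant.integral_mul_generator_add hj hk
    (S.abs_queueLength_target_sub_le j) (S.abs_queueLength_target_sub_le k)
  rw [integral_mul_generator_queueLength hj, integral_mul_generator_queueLength hk,
    hν.integral_carreDuChamp_queueLength hp] at hzero
  linarith

/-- Discriminatory processor sharing enters through `g_k * share_j * M_k = g_j * share_k * M_j`,
which leaves one unknown in the balance equation. -/
theorem IsSteadyState.integral_capacity_mul_share_mul_queueLength (hν : S.IsSteadyState ν)
    (hp : S.IsInvariantEnv p) (j k : Fin K) :
    ∫ x, S.c x.2 * (S.share j x.1 * queueLength k x) ∂ν =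
      S.g j * (∫ x, S.arrivalRate k x.2 * queueLength j x ∂ν
        + ∫ x, S.arrivalRate j x.2 * queueLength k x ∂ν
        + if j = k then 2 * S.avgArrivalRate p k else 0) / (S.mu k * S.g k + S.mu j * S.g j) := by
  have hgj := S.g_pos j
  have hpos : 0 < S.mu k * S.g k + S.mu j * S.g j :=
    add_pos (mul_pos (S.mu_pos k) (S.g_pos k)) (mul_pos (S.mu_pos j) hgj)
  have hsymm : ∀ x, S.serviceRate k x.2 * (S.share k x.1 * queueLength j x)
      = S.mu k * S.g k / S.g j * (S.c x.2 * (S.share j x.1 * queueLength k x)) := fun x => by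
    simp only [serviceRate, share, queueLength]
    field_simp
  have hbalance := hν.second_moment_balance hp j k
  simp only [hsymm] at hbalance
  simp only [serviceRate, mul_assoc (S.mu j), integral_const_mul] at hbalance
  rw [eq_div_iff hpos.ne', add_comm (∫ x, S.arrivalRate k x.2 * queueLength j x ∂ν), ← hbalance]
  field_simp
  ring

theorem sum_share_mul_queueLength (k : Fin K) (x : (Fin K → ℕ) × Fin D) :
    ∑ j, S.share j x.1 * queueLength k x = queueLength k x := by
  rw [← Finset.sum_mul]
  by_cases h : x.1 = 0
  · simp [queueLength, h]
  · rw [S.sum_share h, one_mul]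

theorem IsSteadyState.integral_capacity_mul_queueLength (hν : S.IsSteadyState ν)
    (hp : S.IsInvariantEnv p) (k : Fin K) :
    ∫ x, S.c x.2 * queueLength k x ∂ν = S.avgArrivalRate p k / S.mu k +
      ∑ j, S.g j * (∫ x, S.arrivalRate k x.2 * queueLength j x ∂ν
        + ∫ x, S.arrivalRate j x.2 * queueLength k x ∂ν) / (S.mu k * S.g k + S.mu j * S.g j) := by
  have hk := hν.integrable_queueLength hp k
  have hdiag : S.g k * (2 * S.avgArrivalRate p k) / (S.mu k * S.g k + S.mu k * S.g k)
      = S.avgArrivalRate p k / S.mu k := by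
    have hmu := S.mu_pos k
    have hg := S.g_pos k
    field_simp
    ring
  calc ∫ x, S.c x.2 * queueLength k x ∂ν
      = ∑ j, ∫ x, S.c x.2 * (S.share j x.1 * queueLength k x) ∂ν := by
        rw [← integral_finsetSum _ fun j _ =>
          integrable_environment_mul (integrable_share_mul hk j) S.c]
        simp only [← Finset.mul_sum, sum_share_mul_queueLength]
    _ = _ := by
        simp only [hν.integral_capacity_mul_share_mul_queueLength hp, mul_add _ (_ + _), mul_ite,
          mul_zero, add_div _ (ite _ _ _), ite_div, zero_div, Finset.sum_add_distrib,
          Finset.sum_ite_eq', Finset.mem_univ, if_true, hdiag]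
        rw [add_comm]

variable (S) in
theorem share_mul_ite_sum_pos (k : Fin K) (m : Fin K → ℕ) :
    S.share k m * (if 0 < ∑ j, m j then 1 else 0) = S.share k m := by
  split_ifs with h
  · rw [mul_one]
  · rw [share_eq_zero, mul_zero]
    exact Finset.sum_eq_zero_iff.1 (Nat.eq_zero_of_not_pos h) k (Finset.mem_univ k)

end ModulatedDPS

theorem mainTheorem5 {K D : ℕ} (S : ModulatedDPS K D)
    (π : Fin D → ℝ) (hπ : S.IsInvariantEnv π)
    {Ω : Type*} [MeasurableSpace Ω] (P : Measure Ω)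
    (M : Ω → Fin K → ℕ) (Z : Ω → Fin D) (hM : Measurable M) (hZ : Measurable Z)
    (hstat : S.IsSteadyState (P.map fun ω => (M ω, Z ω))) :
    (∀ k, S.avgArrivalRate π k =
      ∑ d, S.serviceRate k d *
        ∫ ω, S.g k * (M ω k : ℝ) / (∑ j, S.g j * (M ω j : ℝ))
          * (if 0 < ∑ j, M ω j then 1 else 0) * (if Z ω = d then 1 else 0) ∂P) ∧
    (∀ k, Integrable (fun ω => (M ω k : ℝ)) P) ∧
    ∀ k, ∑ d, S.c d * ∫ ω, (M ω k : ℝ) * (if Z ω = d then 1 else 0) ∂P =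
      S.avgArrivalRate π k / S.mu k +
        ∑ d, ∑ j, S.g j *
          ((S.arrivalRate k d * ∫ ω, (M ω j : ℝ) * (if Z ω = d then 1 else 0) ∂P)
            + S.arrivalRate j d * ∫ ω, (M ω k : ℝ) * (if Z ω = d then 1 else 0) ∂P)
          / (S.mu k * S.g k + S.mu j * S.g j) := by
  have hMZ : Measurable fun ω => (M ω, Z ω) := hM.prodMk hZ
  have hprob := hstat.1
  have hlaw : ∀ F : (Fin K → ℕ) × Fin D → ℝ,
      ∫ x, F x ∂P.map (fun ω => (M ω, Z ω)) = ∫ ω, F (M ω, Z ω) ∂P := fun F =>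
    integral_map hMZ.aemeasurable Measurable.of_discrete.aestronglyMeasurable
  have hint : ∀ k, Integrable (fun ω => (M ω k : ℝ)) P := fun k =>
    (hstat.integrable_queueLength hπ k).comp_measurable hMZ
  refine ⟨fun k => ?_, hint, fun k => ?_⟩
  · have hshare : ∀ m : Fin K → ℕ, S.g k * (m k : ℝ) / (∑ j, S.g j * (m j : ℝ))
        * (if 0 < ∑ j, m j then 1 else 0) = S.share k m := S.share_mul_ite_sum_pos k
    have hint_share : Integrable (fun ω => S.share k (M ω)) P :=
      (ModulatedDPS.integrable_share k).comp_measurable hMZ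
    simp only [hshare]
    rw [sum_mul_integral_mul_ite_eq hZ hint_share, ← hstat.integral_serviceRate_mul_share hπ, hlaw]
  · have hbalance := hstat.integral_capacity_mul_queueLength hπ k
    simp only [hlaw, ModulatedDPS.queueLength] at hbalance
    rw [sum_mul_integral_mul_ite_eq hZ (hint k), hbalance, Finset.sum_comm]
    simp only [← Finset.sum_div, ← Finset.mul_sum, Finset.sum_add_distrib,
      sum_mul_integral_mul_ite_eq hZ (hint _)]
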